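/- **Setting.** Let $n=d+m$, let $D\subset\mathbb R^n$ be open, let $M(x)$ be a symmetric positive definite matrix depending smoothly on $x\in D$, and let $U,V:D\to\mathbb R$ and $g:D\to\mathbb R^m$ be smooth, with $V\ge 0$ and $$\mathcal V=\{x\in D: V(x)=0\}=\{x\in D: g(x)=0\}.$$ Assume that $G(x)=g'(x)$ has full rank $m$ on $\mathcal V$ and that there is $\alpha>0$ with $v^{T}\nabla^2V(x)v\ge\alpha\, v^{T}M(x)v$ for all $x\in\mathcal V$ and all $v$ in the $M(x)$-orthogonal complement of $T_x\mathcal V=\ker G(x)$. For $\varepsilon>0$ put $H_\varepsilon(x,y)=\frac12 y^{T}M(x)^{-1}y+U(x)+\frac1{\varepsilon^2}V(x)$. **Normal-form coordinates.** Let $\xi$ be an $\varepsilon$-independent smooth diffeomorphism from an open subset $W$ of $\mathbb R^d\times\mathbb R^m$ onto an open subset $\xi(W)$ of $D$, and let $\chi=\chi_\varepsilon=\xi\circ\phi_\varepsilon$ with $\phi_\varepsilon(q_0,q_1)=(q_0,\varepsilon^{1/2}q_1)$. Suppose that for every $\varepsilon>0$ the canonical transformation $x=\chi(q)$, $y=\chi'(q)^{-T}p$,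 where $q=(q_0,q_1)\in\phi_\varepsilon^{-1}(W)$ and $p=(p_0,p_1)$, transforms $H_\varepsilon$ into $$\tfrac12 p_0^{T}M_0(q_0)^{-1}p_0+\tfrac1{2\varepsilon}p_1^{T}\Omega(q_0)p_1+\tfrac1{2\varepsilon}q_1^{T}\Omega(q_0)q_1+\tfrac12\begin{pmatrix}p_0\\ \varepsilon^{-1/2}p_1\end{pmatrix}^{T}R(q_0,\varepsilon^{1/2}q_1)\begin{pmatrix}p_0\\ \varepsilon^{-1/2}p_1\end{pmatrix}+U(\chi(q)),$$ where $M_0,\Omega,R$ are $\varepsilon$-independent smooth matrix functions (on the relevant domains given by $W$), $M_0(q_0)$ is symmetric positive definite, $\Omega(q_0)$ is diagonal with positive entries, and $R$ is symmetric with $R(q_0,0)=0$ whenever $(q_0,0)\in W$. Define the mollifier $\pi(x)=\chi(q_0,0)$ for $x=\chi(q)$, $q=(q_0,q_1)$ (wherever $(q_0,0)$ is in the domain of $\chi$), and $$\mathcal P(x)=I-\big[G^{T}(GM^{-1}G^{T})^{-1}GM^{-1}\big](x).$$ **Statement.** 1. Under the bounded-energy condition $V(x)=\mathcal O(\varepsilon^2)$,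 $$\pi(x)=x+\mathcal O(\varepsilon),\qquad \pi'(x)^{T}=\mathcal P(x)+\mathcal O(\varepsilon).$$ Precisely: for every compact $K\subset\xi(W)$ and every $c\in\mathbb R$ there are $C$ and $\varepsilon_0>0$ such that for all $0<\varepsilon\le\varepsilon_0$ and all $x\in K$ with $V(x)\le c\,\varepsilon^2$: $(q_0,0)$ lies in the domain of $\chi$ (where $x=\chi(q_0,q_1)$), $\pi$ is differentiable at $x$, $(GM^{-1}G^{T})(x)$ is invertible, $\|\pi(x)-x\|\le C\varepsilon$ and $\|\pi'(x)^{T}-\mathcal P(x)\|\le C\varepsilon$ (Euclidean norm and its operator norm). 2. For every $\varepsilon>0$ and every $X\in\xi(W)$ with $g(X)=0$, the point $(q_0,0)$ (where $X=\chi(q_0,q_1)$) lies in the domain of $\chi$, $\pi$ is differentiable at $X$, $(GM^{-1}G^{T})(X)$ is invertible, and $\pi'(X)^{T}=\mathcal P(X)$. -/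

import Mathlib

open scoped Matrix ContDiff

noncomputable section

namespace StiffMech

/-- The Jacobian matrix `f'(x)`, with entries `∂ f_i / ∂ x_j`. -/
def jacobian {ι κ : Type*} [Fintype ι] [Fintype κ] [DecidableEq κ]
    (f : EuclideanSpace ℝ κ → EuclideanSpace ℝ ι) (x : EuclideanSpace ℝ κ) : Matrix ι κ ℝ :=
  fun i j => fderiv ℝ f x (EuclideanSpace.single j 1) i

/-- The data of the Hamiltonian `½ yᵀ M(x)⁻¹ y + U(x) + ε⁻² V(x)` on an open set `D ⊆ ℝⁿ`,
together with a constraint function `g : D → ℝᵐ`. The stiff potential `V` attains its minimum `0`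
on `{g = 0}`, the Jacobian of `g` has full rank there, and `V` is strongly convex in the directions
`M`-orthogonal to the constraint manifold. The tangent space of the manifold at `x` is the kernel
of `g'(x)`. -/
structure StiffSystem (n m : ℕ) where
  D : Set (EuclideanSpace ℝ (Fin n))
  isOpen_D : IsOpen D
  M : EuclideanSpace ℝ (Fin n) → Matrix (Fin n) (Fin n) ℝ
  smooth_M : ∀ i j, ContDiffOn ℝ ∞ (fun x => M x i j) D
  posDef_M : ∀ x ∈ D, (M x).PosDef
  U : EuclideanSpace ℝ (Fin n) → ℝ
  smooth_U : ContDiffOn ℝ ∞ U D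
  V : EuclideanSpace ℝ (Fin n) → ℝ
  smooth_V : ContDiffOn ℝ ∞ V D
  V_nonneg : ∀ x ∈ D, 0 ≤ V x
  g : EuclideanSpace ℝ (Fin n) → EuclideanSpace ℝ (Fin m)
  smooth_g : ContDiffOn ℝ ∞ g D
  V_eq_zero_iff : ∀ x ∈ D, V x = 0 ↔ g x = 0
  full_rank : ∀ x ∈ D, g x = 0 → (jacobian g x).rank = m
  strongly_convex : ∃ α : ℝ, 0 < α ∧ ∀ x ∈ D, V x = 0 → ∀ v : EuclideanSpace ℝ (Fin n),
    (∀ w : EuclideanSpace ℝ (Fin n), jacobian g x *ᵥ w.ofLp = 0 → v.ofLp ⬝ᵥ (M x *ᵥ w.ofLp) = 0) →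
    α * (v.ofLp ⬝ᵥ (M x *ᵥ v.ofLp)) ≤ fderiv ℝ (fderiv ℝ V) x v v

namespace StiffSystem

variable {n m : ℕ} (S : StiffSystem n m)

/-- The Hamiltonian `H(x,y) = ½ yᵀ M(x)⁻¹ y + U(x) + ε⁻² V(x)`. -/
def hamiltonian (ε : ℝ) (x : EuclideanSpace ℝ (Fin n)) (y : Fin n → ℝ) : ℝ :=
  1 / 2 * (y ⬝ᵥ ((S.M x)⁻¹ *ᵥ y)) + S.U x + 1 / ε ^ 2 * S.V x

/-- The constraint Jacobian `G(x) = g'(x)`. -/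
def G (x : EuclideanSpace ℝ (Fin n)) : Matrix (Fin m) (Fin n) ℝ := jacobian S.g x

/-- The Gram matrix `G M⁻¹ Gᵀ` at `x`. -/
def gram (x : EuclideanSpace ℝ (Fin n)) : Matrix (Fin m) (Fin m) ℝ :=
  S.G x * (S.M x)⁻¹ * (S.G x)ᵀ

/-- The projection `P = I - Gᵀ (G M⁻¹ Gᵀ)⁻¹ G M⁻¹` at `x`. -/
def P (x : EuclideanSpace ℝ (Fin n)) : Matrix (Fin n) (Fin n) ℝ :=
  1 - (S.G x)ᵀ * (S.gram x)⁻¹ * S.G x * (S.M x)⁻¹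

end StiffSystem

/-- The slow component `q₀` of `q = (q₀, q₁)`. -/
def slow {d m : ℕ} (q : EuclideanSpace ℝ (Fin d ⊕ Fin m)) : EuclideanSpace ℝ (Fin d) :=
  WithLp.toLp 2 fun i => q (Sum.inl i)

/-- The map `(q₀, q₁) ↦ (q₀, 0)`. -/
def dropFast {d m : ℕ} (q : EuclideanSpace ℝ (Fin d ⊕ Fin m)) :
    EuclideanSpace ℝ (Fin d ⊕ Fin m) :=
  WithLp.toLp 2 (Sum.elim (fun i => q (Sum.inl i)) 0)

/-- The map `(q₀, q₁) ↦ (q₀, a q₁)`. -/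
def scaleFast {d m : ℕ} (a : ℝ) (q : EuclideanSpace ℝ (Fin d ⊕ Fin m)) :
    EuclideanSpace ℝ (Fin d ⊕ Fin m) :=
  WithLp.toLp 2 (Sum.elim (fun i => q (Sum.inl i)) (fun k => a * q (Sum.inr k)))

theorem continuous_scaleFast {d m : ℕ} (a : ℝ) :
    Continuous (scaleFast a : EuclideanSpace ℝ (Fin d ⊕ Fin m) → _) := by
  unfold scaleFast
  refine (PiLp.continuous_toLp 2 _).comp (continuous_pi ?_)
  rintro (i | k)
  · simp only [Sum.elim_inl]; fun_prop
  · simp only [Sum.elim_inr]; fun_prop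

theorem scaleFast_scaleFast {d m : ℕ} {a b : ℝ} (h : a * b = 1)
    (q : EuclideanSpace ℝ (Fin d ⊕ Fin m)) : scaleFast a (scaleFast b q) = q := by
  ext i
  rcases i with i | k
  · simp [scaleFast]
  · simp [scaleFast, ← mul_assoc, h]

/-- The rescaling `φ_ε(q₀, q₁) = (q₀, ε^{1/2} q₁)`. -/
def rescale (d m : ℕ) (ε : ℝ) (hε : 0 < ε) :
    EuclideanSpace ℝ (Fin d ⊕ Fin m) ≃ₜ EuclideanSpace ℝ (Fin d ⊕ Fin m) where
  toFun := scaleFast (√ε)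
  invFun := scaleFast (√ε)⁻¹
  left_inv := scaleFast_scaleFast (inv_mul_cancel₀ (Real.sqrt_pos.2 hε).ne')
  right_inv := scaleFast_scaleFast (mul_inv_cancel₀ (Real.sqrt_pos.2 hε).ne')
  continuous_toFun := continuous_scaleFast _
  continuous_invFun := continuous_scaleFast _

/-- The change of coordinates `χ = ξ ∘ φ_ε`. -/
def chi {n d m : ℕ}
    (ξ : OpenPartialHomeomorph (EuclideanSpace ℝ (Fin d ⊕ Fin m)) (EuclideanSpace ℝ (Fin n)))
    (ε : ℝ) (hε : 0 < ε) :
    OpenPartialHomeomorph (EuclideanSpace ℝ (Fin d ⊕ Fin m)) (EuclideanSpace ℝ (Fin n)) :=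
  (rescale d m ε hε).toOpenPartialHomeomorph.trans ξ

/-- The normal-form Hamiltonian
`½ p₀ᵀ M₀(q₀)⁻¹ p₀ + (2ε)⁻¹ p₁ᵀ Ω(q₀) p₁ + (2ε)⁻¹ q₁ᵀ Ω(q₀) q₁ + ½ wᵀ R(q₀, ε^{1/2} q₁) w
+ Uc(q₀, ε^{1/2} q₁)`, where `w = (p₀, ε^{-1/2} p₁)` and `Ω(q₀)` is the diagonal matrix of the
frequencies `freq(q₀) k`. -/
def normalHamiltonian {d m : ℕ}
    (M₀ : EuclideanSpace ℝ (Fin d) → Matrix (Fin d) (Fin d) ℝ)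
    (freq : EuclideanSpace ℝ (Fin d) → Fin m → ℝ)
    (R : EuclideanSpace ℝ (Fin d ⊕ Fin m) → Matrix (Fin d ⊕ Fin m) (Fin d ⊕ Fin m) ℝ)
    (Uc : EuclideanSpace ℝ (Fin d ⊕ Fin m) → ℝ)
    (ε : ℝ) (q : EuclideanSpace ℝ (Fin d ⊕ Fin m)) (p : Fin d ⊕ Fin m → ℝ) : ℝ :=
  let q₁ : Fin m → ℝ := fun k => q (Sum.inr k)
  let p₀ : Fin d → ℝ := fun i => p (Sum.inl i)
  let p₁ : Fin m → ℝ := fun k => p (Sum.inr k)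
  let Ω : Matrix (Fin m) (Fin m) ℝ := Matrix.diagonal (freq (slow q))
  let w : Fin d ⊕ Fin m → ℝ := Sum.elim p₀ (fun k => (√ε)⁻¹ * p₁ k)
  1 / 2 * (p₀ ⬝ᵥ ((M₀ (slow q))⁻¹ *ᵥ p₀))
    + 1 / (2 * ε) * (p₁ ⬝ᵥ (Ω *ᵥ p₁))
    + 1 / (2 * ε) * (q₁ ⬝ᵥ (Ω *ᵥ q₁))
    + 1 / 2 * (w ⬝ᵥ (R (scaleFast (√ε) q) *ᵥ w))
    + Uc (scaleFast (√ε) q)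

/-- Normal-form coordinates for the stiff system `S`: an `ε`-independent smooth diffeomorphism `ξ`
from an open set of `ℝᵈ × ℝᵐ` onto an open subset of `D` such that, for every `ε > 0`, the canonical
transformation `x = χ(q)`, `y = χ'(q)⁻ᵀ p` with `χ = ξ ∘ φ_ε` brings the Hamiltonian into normal
form. The momentum relation is written as `p = χ'(q)ᵀ y`. -/
structure NormalForm {n m : ℕ} (S : StiffSystem n m) (d : ℕ) where
  ξ : OpenPartialHomeomorph (EuclideanSpace ℝ (Fin d ⊕ Fin m)) (EuclideanSpace ℝ (Fin n))
  target_subset : ξ.target ⊆ S.D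
  smooth_ξ : ContDiffOn ℝ ∞ ξ ξ.source
  smooth_ξ_symm : ContDiffOn ℝ ∞ ξ.symm ξ.target
  M₀ : EuclideanSpace ℝ (Fin d) → Matrix (Fin d) (Fin d) ℝ
  smooth_M₀ : ∀ i j, ContDiffOn ℝ ∞ (fun q₀ => M₀ q₀ i j) (slow '' ξ.source)
  posDef_M₀ : ∀ q₀ ∈ slow '' ξ.source, (M₀ q₀).PosDef
  freq : EuclideanSpace ℝ (Fin d) → Fin m → ℝ
  smooth_freq : ∀ k, ContDiffOn ℝ ∞ (fun q₀ => freq q₀ k) (slow '' ξ.source)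
  freq_pos : ∀ q₀ ∈ slow '' ξ.source, ∀ k, 0 < freq q₀ k
  R : EuclideanSpace ℝ (Fin d ⊕ Fin m) → Matrix (Fin d ⊕ Fin m) (Fin d ⊕ Fin m) ℝ
  smooth_R : ∀ i j, ContDiffOn ℝ ∞ (fun q => R q i j) ξ.source
  symm_R : ∀ q ∈ ξ.source, (R q).IsSymm
  R_zero : ∀ q ∈ ξ.source, dropFast q = q → R q = 0
  transform : ∀ (ε : ℝ) (hε : 0 < ε), ∀ q ∈ (chi ξ ε hε).source, ∀ y : Fin n → ℝ,
    S.hamiltonian ε (chi ξ ε hε q) y =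
      normalHamiltonian M₀ freq R (fun q' => S.U (ξ q')) ε q ((jacobian (chi ξ ε hε) q)ᵀ *ᵥ y)

/-- The mollifier `π(x) = χ(q₀, 0)` for `x = χ(q)`, `q = (q₀, q₁)`. It is meaningful at points
`x` in the range of `χ` for which `(q₀, 0)` lies in the domain of `χ`. -/
def mollifier {n d m : ℕ}
    (χ : OpenPartialHomeomorph (EuclideanSpace ℝ (Fin d ⊕ Fin m)) (EuclideanSpace ℝ (Fin n)))
    (x : EuclideanSpace ℝ (Fin n)) : EuclideanSpace ℝ (Fin n) :=
  χ (dropFast (χ.symm x))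

end StiffMech

end

/-! Dropping the fast variable commutes with rescaling it, so the mollifier does not depend on `ε`:
it is `ξ ∘ dropFast ∘ ξ⁻¹`, called `proj`. All information about the normal form is read off from
the Hamiltonian identity at `ε = 1`.

Zero momentum gives `V(ξ(w)) = ½ ∑ ω_k w_k²` over the fast coordinates (`V_eq`), so the constraint
manifold is `{q₁ = 0}` in the chart. There `R` vanishes, and comparing quadratic forms in `y` gives
`M⁻¹ = A diag(M₀⁻¹, Ω) Aᵀ` with `A = ξ'` (`inv_M_eq`). Since `g ∘ ξ` vanishes on `{q₁ = 0}`, the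
product `G A` has zero slow block (`G_mul_jacobian`). Linear algebra then yields `P = (A diag(1, 0)
A⁻¹)ᵀ = (π')ᵀ` on the manifold (`constraint_projection_eq`).

Off the manifold, frequencies bounded below on a compact set turn `V ≤ c ε²` into `|q₁| = O(ε)`. The
maps `ξ` and `(π')ᵀ - P` (read in the chart) are locally Lipschitz near `{q₁ = 0}`, and the latter
vanishes there, so both errors are `O(|q₁|)`; compactness makes the constants uniform. -/

open Filter Topology

namespace StiffMech

/-! ### Linear algebra of the constraint projection. -/

section LinearAlgebra

variable {ι κ : Type*} [Fintype ι] [Fintype κ] [DecidableEq ι] [DecidableEq κ]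

/-- A symmetric real matrix is determined by its quadratic form. -/
theorem eq_of_dotProduct_mulVec_eq {A B : Matrix ι ι ℝ} (hA : A.IsSymm) (hB : B.IsSymm)
    (h : ∀ y : ι → ℝ, y ⬝ᵥ (A *ᵥ y) = y ⬝ᵥ (B *ᵥ y)) : A = B := by
  ext i j
  -- Polarization on basis vectors.
  have key := h (Pi.single i 1 + Pi.single j 1)
  have hi := h (Pi.single i 1)
  have hj := h (Pi.single j 1)
  have sA := hA.apply i j
  have sB := hB.apply i j
  simp only [Matrix.mulVec_add, dotProduct_add, add_dotProduct, Matrix.mulVec_single_one,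
    single_one_dotProduct, Matrix.col_apply] at key hi hj
  linarith

theorem isUnit_of_rank_eq_card {B : Matrix ι ι ℝ} (h : Fintype.card ι ≤ B.rank) : IsUnit B := by
  rw [← Matrix.mulVec_surjective_iff_isUnit]
  have : LinearMap.range B.mulVecLin = ⊤ := by
    apply Submodule.eq_top_of_finrank_eq
    refine le_antisymm (Submodule.finrank_le _) ?_
    simpa [Matrix.rank] using h
  exact LinearMap.range_eq_top.1 this

/-- The projection along the constraint directions, in coordinates in which the inverse mass matrix
is block diagonal and the constraint Jacobian vanishes on the first block. -/
theorem constraint_projection_eq {ν : Type*} [Fintype ν] [DecidableEq ν]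
    {A : Matrix ν (ι ⊕ κ) ℝ} {A' : Matrix (ι ⊕ κ) ν ℝ}
    (hAA' : A * A' = 1) (hA'A : A' * A = 1) {G : Matrix κ ν ℝ} {K : Matrix ι ι ℝ}
    {Ω : Matrix κ κ ℝ} (hΩ : IsUnit Ω) (hG : G.rank = Fintype.card κ)
    (hGA : G * A * (Matrix.fromBlocks 1 0 0 0 : Matrix (ι ⊕ κ) (ι ⊕ κ) ℝ) = 0) {Minv : Matrix ν ν ℝ}
    (hM : Minv = A * (Matrix.fromBlocks K 0 0 Ω : Matrix (ι ⊕ κ) (ι ⊕ κ) ℝ) * Aᵀ) :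
    IsUnit (G * Minv * Gᵀ).det ∧
      1 - Gᵀ * (G * Minv * Gᵀ)⁻¹ * G * Minv =
        (A * (Matrix.fromBlocks 1 0 0 0 : Matrix (ι ⊕ κ) (ι ⊕ κ) ℝ) * A')ᵀ := by
  obtain ⟨B, hB⟩ : ∃ B : Matrix κ κ ℝ, G * A = Matrix.fromCols (0 : Matrix κ ι ℝ) B := by
    refine ⟨(G * A).toCols₂, ?_⟩
    have h := Matrix.fromCols_toCols (G * A)
    rw [← h, Matrix.fromCols_mul_fromBlocks, ← Matrix.fromCols_zero,
      Matrix.fromCols_inj.eq_iff] at hGA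
    simp only [Matrix.mul_one, Matrix.mul_zero, add_zero] at hGA
    rw [← hGA.1, h]
  have hGeq : G = Matrix.fromCols (0 : Matrix κ ι ℝ) B * A' := by
    rw [← hB, Matrix.mul_assoc, hAA', Matrix.mul_one]
  -- `G` factors through the square block `B`, so full rank of `G` forces `B` to be invertible.
  have hBu : IsUnit B := by
    apply isUnit_of_rank_eq_card
    rw [← hG, hGeq]
    refine (Matrix.rank_mul_le_left _ _).trans ?_
    have : Matrix.fromCols (0 : Matrix κ ι ℝ) B =
        B * Matrix.fromCols (0 : Matrix κ ι ℝ) (1 : Matrix κ κ ℝ) := by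
      rw [Matrix.mul_fromCols, Matrix.mul_zero, Matrix.mul_one]
    rw [this]
    exact Matrix.rank_mul_le_left _ _
  have hAT : Aᵀ * A'ᵀ = 1 := by rw [← Matrix.transpose_mul, hA'A, Matrix.transpose_one]
  have hGM : G * Minv = Matrix.fromCols (0 : Matrix κ ι ℝ) (B * Ω) * Aᵀ := by
    rw [hM, ← Matrix.mul_assoc, ← Matrix.mul_assoc, hB, Matrix.fromCols_mul_fromBlocks]
    simp
  have hGT : Gᵀ = A'ᵀ * Matrix.fromRows (0 : Matrix ι κ ℝ) Bᵀ := by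
    rw [hGeq, Matrix.transpose_mul, Matrix.transpose_fromCols, Matrix.transpose_zero]
  have hgram : G * Minv * Gᵀ = B * Ω * Bᵀ := by
    rw [hGM, hGT, Matrix.mul_assoc, ← Matrix.mul_assoc Aᵀ, hAT, Matrix.one_mul,
      Matrix.fromCols_mul_fromRows]
    simp
  have hBTu : IsUnit Bᵀ := (Matrix.isUnit_transpose B).2 hBu
  refine ⟨?_, ?_⟩
  · rw [hgram, ← Matrix.isUnit_iff_isUnit_det]
    exact (hBu.mul hΩ).mul hBTu
  -- All dependence on `B` and `Ω` cancels here, leaving the coordinate projection onto the fast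
  -- block, conjugated by `Aᵀ`.
  · have hcancel : Bᵀ * (B * Ω * Bᵀ)⁻¹ * (B * Ω) = 1 := by
      rw [Matrix.mul_inv_rev, ← Matrix.mul_assoc Bᵀ,
        Matrix.mul_nonsing_inv _ ((Matrix.isUnit_iff_isUnit_det _).1 hBTu), Matrix.one_mul,
        Matrix.nonsing_inv_mul _ ((Matrix.isUnit_iff_isUnit_det _).1 (hBu.mul hΩ))]
    have hcore : Gᵀ * (G * Minv * Gᵀ)⁻¹ * G * Minv
        = A'ᵀ * (Matrix.fromBlocks 0 0 0 1 : Matrix (ι ⊕ κ) (ι ⊕ κ) ℝ) * Aᵀ := by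
      rw [Matrix.mul_assoc _ G, hgram, hGM, hGT]
      have : Matrix.fromRows (0 : Matrix ι κ ℝ) Bᵀ * (B * Ω * Bᵀ)⁻¹ *
          Matrix.fromCols (0 : Matrix κ ι ℝ) (B * Ω) = Matrix.fromBlocks 0 0 0 1 := by
        rw [Matrix.fromRows_mul, Matrix.fromRows_mul_fromCols, hcancel]
        simp
      rw [← this]
      simp only [Matrix.mul_assoc]
    have hE : (Matrix.fromBlocks 1 0 0 0 : Matrix (ι ⊕ κ) (ι ⊕ κ) ℝ)
        = 1 - Matrix.fromBlocks 0 0 0 1 := by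
      rw [← Matrix.fromBlocks_one, sub_eq_add_neg, Matrix.fromBlocks_neg, Matrix.fromBlocks_add]
      simp
    rw [hcore, hE]
    simp only [Matrix.transpose_mul, Matrix.transpose_sub, Matrix.transpose_one,
      Matrix.fromBlocks_transpose, Matrix.transpose_zero, Matrix.mul_sub, Matrix.sub_mul,
      Matrix.mul_one, hAA', Matrix.mul_assoc]

end LinearAlgebra

/-! ### Smoothness of matrix expressions, entry by entry. -/

section MatrixSmoothness

variable {ι κ : Type*} [Fintype ι] [Fintype κ]
  {E : Type*} [NormedAddCommGroup E] [NormedSpace ℝ E] {k : WithTop ℕ∞} {x : E}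

theorem contDiffAt_matrix_mul {ν ρ : Type*} {A : E → Matrix ν ι ℝ} {B : E → Matrix ι ρ ℝ}
    (hA : ∀ i j, ContDiffAt ℝ k (fun y => A y i j) x)
    (hB : ∀ i j, ContDiffAt ℝ k (fun y => B y i j) x) (i : ν) (j : ρ) :
    ContDiffAt ℝ k (fun y => (A y * B y) i j) x := by
  simp only [Matrix.mul_apply]
  exact ContDiffAt.sum fun l _ => (hA i l).mul (hB l j)

theorem contDiffAt_matrix_det [DecidableEq ι] {A : E → Matrix ι ι ℝ}
    (hA : ∀ i j, ContDiffAt ℝ k (fun y => A y i j) x) :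
    ContDiffAt ℝ k (fun y => (A y).det) x := by
  simp only [Matrix.det_apply']
  exact ContDiffAt.sum fun σ _ => contDiffAt_const.mul (contDiffAt_prod fun i _ => hA _ _)

theorem contDiffAt_matrix_inv [DecidableEq ι] {A : E → Matrix ι ι ℝ}
    (hA : ∀ i j, ContDiffAt ℝ k (fun y => A y i j) x) (hx : IsUnit (A x).det) (i j : ι) :
    ContDiffAt ℝ k (fun y => (A y)⁻¹ i j) x := by
  simp only [Matrix.inv_def, Ring.inverse_eq_inv', Matrix.smul_apply, smul_eq_mul,
    Matrix.adjugate_apply]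
  refine ((contDiffAt_matrix_det hA).inv hx.ne_zero).mul (contDiffAt_matrix_det fun a b => ?_)
  -- Adjugate entries are determinants of `A` with row `j` replaced by a constant vector.
  by_cases h : a = j
  · subst h
    simpa using contDiffAt_const
  · simpa [Matrix.updateRow_ne h] using hA a b

theorem contDiffAt_toEuclideanCLM [DecidableEq ι] {A : E → Matrix ι ι ℝ}
    (hA : ∀ i j, ContDiffAt ℝ k (fun y => A y i j) x) :
    ContDiffAt ℝ k (fun y => Matrix.toEuclideanCLM (𝕜 := ℝ) (A y)) x := by
  have h (y : E) : Matrix.toEuclideanCLM (𝕜 := ℝ) (A y) =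
      ∑ i, ∑ j, A y i j • Matrix.toEuclideanCLM (𝕜 := ℝ) (Matrix.single i j (1 : ℝ)) := by
    conv_lhs => rw [Matrix.matrix_eq_sum_single (A y)]
    simp only [map_sum]
    refine Finset.sum_congr rfl fun i _ => Finset.sum_congr rfl fun j _ => ?_
    rw [← map_smul, Matrix.smul_single, smul_eq_mul, mul_one]
  simp only [h]
  exact ContDiffAt.sum fun i _ => ContDiffAt.sum fun j _ => (hA i j).smul contDiffAt_const

end MatrixSmoothness

/-! ### Calculus of Jacobian matrices. -/

section Jacobian

variable {ι κ ν : Type*} [Fintype ι] [Fintype κ] [Fintype ν] [DecidableEq κ]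

theorem jacobian_mulVec (f : EuclideanSpace ℝ κ → EuclideanSpace ℝ ι) (x : EuclideanSpace ℝ κ)
    (v : κ → ℝ) : jacobian f x *ᵥ v = (fderiv ℝ f x (WithLp.toLp 2 v)).ofLp := by
  have hv : WithLp.toLp 2 v = ∑ j, v j • EuclideanSpace.single j (1 : ℝ) := by
    ext i
    simp [Pi.single_apply]
  rw [hv]
  ext i
  simp [Matrix.mulVec, dotProduct, jacobian, mul_comm]

theorem jacobian_comp [DecidableEq ι] {f : EuclideanSpace ℝ ι → EuclideanSpace ℝ ν}
    {h : EuclideanSpace ℝ κ → EuclideanSpace ℝ ι} {x : EuclideanSpace ℝ κ}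
    (hf : DifferentiableAt ℝ f (h x)) (hh : DifferentiableAt ℝ h x) :
    jacobian (fun y => f (h y)) x = jacobian f (h x) * jacobian h x := by
  apply Matrix.mulVec_injective
  ext1 v
  rw [← Matrix.mulVec_mulVec, jacobian_mulVec, jacobian_mulVec, jacobian_mulVec]
  rw [show (fun y => f (h y)) = f ∘ h from rfl, fderiv_comp x hf hh]
  rfl

theorem jacobian_id (x : EuclideanSpace ℝ κ) : jacobian (fun y => y) x = 1 := by
  apply Matrix.mulVec_injective
  ext1 v
  rw [jacobian_mulVec]
  simp

theorem jacobian_const (c : EuclideanSpace ℝ ι) (x : EuclideanSpace ℝ κ) :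
    jacobian (fun _ => c) x = 0 := by
  apply Matrix.mulVec_injective
  ext1 v
  rw [jacobian_mulVec]
  simp

theorem jacobian_congr {f h : EuclideanSpace ℝ κ → EuclideanSpace ℝ ι} {x : EuclideanSpace ℝ κ}
    (hfh : f =ᶠ[𝓝 x] h) : jacobian f x = jacobian h x := by
  unfold jacobian
  rw [hfh.fderiv_eq]

theorem contDiffAt_jacobian {f : EuclideanSpace ℝ κ → EuclideanSpace ℝ ι}
    {x : EuclideanSpace ℝ κ} {k l : WithTop ℕ∞} (hf : ContDiffAt ℝ k f x) (hl : l + 1 ≤ k)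
    (i : ι) (j : κ) : ContDiffAt ℝ l (fun y => jacobian f y i j) x := by
  have h := (hf.fderiv_right hl).clm_apply (contDiffAt_const (c := EuclideanSpace.single j (1 : ℝ)))
  exact contDiffAt_euclidean.1 h i

end Jacobian

/-! ### The coordinate projection and the disappearance of `ε`. -/

section DropFast

variable {d m : ℕ}

/-- `dropFast` as a continuous linear map. -/
noncomputable def dropFastL (d m : ℕ) :
    EuclideanSpace ℝ (Fin d ⊕ Fin m) →L[ℝ] EuclideanSpace ℝ (Fin d ⊕ Fin m) :=
  Matrix.toEuclideanCLM (𝕜 := ℝ) (Matrix.fromBlocks 1 0 0 0)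

theorem dropFastL_apply (q : EuclideanSpace ℝ (Fin d ⊕ Fin m)) : dropFastL d m q = dropFast q := by
  ext i
  rw [dropFastL, Matrix.ofLp_toEuclideanCLM, Matrix.fromBlocks_mulVec]
  rcases i with i | i <;> simp [dropFast]

theorem dropFast_eq_coe : (dropFast : EuclideanSpace ℝ (Fin d ⊕ Fin m) → _) = dropFastL d m :=
  funext fun q => (dropFastL_apply q).symm

theorem contDiff_dropFast {k : WithTop ℕ∞} :
    ContDiff ℝ k (dropFast : EuclideanSpace ℝ (Fin d ⊕ Fin m) → _) := by
  rw [dropFast_eq_coe]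
  exact (dropFastL d m).contDiff

theorem jacobian_dropFast (q : EuclideanSpace ℝ (Fin d ⊕ Fin m)) :
    jacobian dropFast q = Matrix.fromBlocks 1 0 0 0 := by
  apply Matrix.mulVec_injective
  ext1 v
  rw [jacobian_mulVec, dropFast_eq_coe, ContinuousLinearMap.fderiv, dropFastL,
    Matrix.ofLp_toEuclideanCLM]

theorem dropFast_dropFast (q : EuclideanSpace ℝ (Fin d ⊕ Fin m)) :
    dropFast (dropFast q) = dropFast q := by
  ext i
  rcases i with i | i <;> simp [dropFast]

theorem scaleFast_dropFast (a : ℝ) (q : EuclideanSpace ℝ (Fin d ⊕ Fin m)) :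
    scaleFast a (dropFast q) = dropFast q := by
  ext i
  rcases i with i | i <;> simp [dropFast, scaleFast]

theorem dropFast_scaleFast (a : ℝ) (q : EuclideanSpace ℝ (Fin d ⊕ Fin m)) :
    dropFast (scaleFast a q) = dropFast q := by
  ext i
  rcases i with i | i <;> simp [dropFast, scaleFast]

theorem scaleFast_one (q : EuclideanSpace ℝ (Fin d ⊕ Fin m)) : scaleFast 1 q = q := by
  ext i
  rcases i with i | i <;> simp [scaleFast]

theorem norm_dropFast_sub_sq (q : EuclideanSpace ℝ (Fin d ⊕ Fin m)) :
    ‖dropFast q - q‖ ^ 2 = ∑ k, q (Sum.inr k) ^ 2 := by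
  simp [EuclideanSpace.norm_sq_eq, Fintype.sum_sum_type, dropFast]

theorem continuous_slow : Continuous (slow : EuclideanSpace ℝ (Fin d ⊕ Fin m) → _) := by
  unfold slow
  exact (PiLp.continuous_toLp 2 _).comp (by fun_prop)

variable {n : ℕ}
  (ξ : OpenPartialHomeomorph (EuclideanSpace ℝ (Fin d ⊕ Fin m)) (EuclideanSpace ℝ (Fin n)))

/-- The rescaling acts only on the coordinates that `dropFast` kills, so both scalings cancel. -/
theorem mollifier_chi {ε : ℝ} (hε : 0 < ε) :
    mollifier (chi ξ ε hε) = fun x => ξ (dropFast (ξ.symm x)) := by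
  ext1 x
  change ξ (scaleFast (√ε) (dropFast (scaleFast (√ε)⁻¹ (ξ.symm x)))) = _
  rw [scaleFast_dropFast, dropFast_scaleFast]

theorem dropFast_chi_symm_mem_iff {ε : ℝ} (hε : 0 < ε) (x : EuclideanSpace ℝ (Fin n)) :
    dropFast ((chi ξ ε hε).symm x) ∈ (chi ξ ε hε).source ↔ dropFast (ξ.symm x) ∈ ξ.source := by
  have h1 : (chi ξ ε hε).symm x = scaleFast (√ε)⁻¹ (ξ.symm x) := rfl
  have h2 : (chi ξ ε hε).source = scaleFast (√ε) ⁻¹' ξ.source := by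
    simp [chi, rescale]
  rw [h1, h2, dropFast_scaleFast, Set.mem_preimage, scaleFast_dropFast]

end DropFast

/-! ### Uniform and local Lipschitz estimates. -/

/-- If a property with a constant, monotone in that constant, holds locally near the zeros of a
continuous function `ρ` on a compact set, then it holds uniformly where `ρ` is small. -/
theorem IsCompact.exists_uniform_of_eventually {X : Type*} [TopologicalSpace X] {L : Set X}
    (hL : IsCompact L) {ρ : X → ℝ} (hρ : Continuous ρ) {p : ℝ → X → Prop}
    (hp : ∀ x C C', C ≤ C' → p C x → p C' x)
    (h0 : ∀ x ∈ L, ρ x ≤ 0 → ∃ C, ∀ᶠ y in 𝓝[L] x, p C y) :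
    ∃ C δ, 0 < δ ∧ ∀ x ∈ L, ρ x ≤ δ → p C x := by
  refine hL.induction_on (p := fun s => ∃ C δ, 0 < δ ∧ ∀ x ∈ s, ρ x ≤ δ → p C x)
    ⟨0, 1, one_pos, by simp⟩ ?_ ?_ ?_
  · rintro s t hst ⟨C, δ, hδ, h⟩
    exact ⟨C, δ, hδ, fun x hx => h x (hst hx)⟩
  · rintro s t ⟨C, δ, hδ, h⟩ ⟨C', δ', hδ', h'⟩
    refine ⟨max C C', min δ δ', lt_min hδ hδ', ?_⟩
    rintro x (hx | hx) hxδ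
    · exact hp _ _ _ (le_max_left _ _) (h x hx (hxδ.trans (min_le_left _ _)))
    · exact hp _ _ _ (le_max_right _ _) (h' x hx (hxδ.trans (min_le_right _ _)))
  · intro x hx
    rcases le_or_gt (ρ x) 0 with hx0 | hx0
    · obtain ⟨C, hC⟩ := h0 x hx hx0
      exact ⟨_, hC, C, 1, one_pos, fun y hy _ => hy⟩
    -- Away from the zeros of `ρ`, the choice `δ = ρ x / 2` makes the claim vacuous nearby.
    · refine ⟨{y | ρ x / 2 < ρ y}, mem_nhdsWithin_of_mem_nhds
        (hρ.continuousAt.eventually_const_lt (half_lt_self hx0)), 0, ρ x / 2, half_pos hx0, ?_⟩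
      intro y hy hy'
      exact absurd hy' (not_le.2 hy)

/-- A `C¹` function is Lipschitz along a map near a fixed point of that map. -/
theorem exists_eventually_norm_sub_le_of_contDiffAt {E F : Type*} [NormedAddCommGroup E]
    [NormedSpace ℝ E] [NormedAddCommGroup F] [NormedSpace ℝ F] {f : E → F} {T : E → E}
    (hT : Continuous T) {x : E} (hx : T x = x) (hf : ContDiffAt ℝ 1 f x) :
    ∃ C, ∀ᶠ y in 𝓝 x, ‖f (T y) - f y‖ ≤ C * ‖T y - y‖ := by
  obtain ⟨K, t, ht, hK⟩ := hf.exists_lipschitzOnWith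
  refine ⟨K, ?_⟩
  have hTt : ∀ᶠ y in 𝓝 x, T y ∈ t := hT.continuousAt.eventually (by rwa [hx])
  filter_upwards [ht, hTt] with y hy hTy
  exact hK.norm_sub_le hTy hy

/-! ### Geometry of the constraint manifold in the chart. -/

namespace NormalForm

variable {n m d : ℕ} {S : StiffSystem n m} (N : NormalForm S d)

/-- The Hamiltonian identity in the unscaled coordinates. -/
theorem hamiltonian_eq {w : EuclideanSpace ℝ (Fin d ⊕ Fin m)} (hw : w ∈ N.ξ.source)
    (y : Fin n → ℝ) :
    S.hamiltonian 1 (N.ξ w) y =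
      normalHamiltonian N.M₀ N.freq N.R (fun q => S.U (N.ξ q)) 1 w ((jacobian N.ξ w)ᵀ *ᵥ y) := by
  have hfun : (chi N.ξ 1 one_pos : EuclideanSpace ℝ (Fin d ⊕ Fin m) → _) = N.ξ := by
    ext1 q
    change N.ξ (scaleFast (√1) q) = N.ξ q
    rw [Real.sqrt_one, scaleFast_one]
  have hsrc : w ∈ (chi N.ξ 1 one_pos).source := by
    simp only [chi, rescale, OpenPartialHomeomorph.trans_source]
    simpa [scaleFast_one] using hw
  have h := N.transform 1 one_pos w hsrc y
  rwa [hfun] at h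

/-- At zero momentum all kinetic terms, including the one with `R`, vanish, and `U` cancels. -/
theorem V_eq {w : EuclideanSpace ℝ (Fin d ⊕ Fin m)} (hw : w ∈ N.ξ.source) :
    S.V (N.ξ w) = 1 / 2 * ∑ k, N.freq (slow w) k * w (Sum.inr k) ^ 2 := by
  have h := N.hamiltonian_eq hw 0
  have h0 : (Sum.elim (fun _ => 0) (fun _ => 0) : Fin d ⊕ Fin m → ℝ) = 0 := by
    ext i
    rcases i with i | i <;> rfl
  simp only [StiffSystem.hamiltonian, normalHamiltonian, Matrix.mulVec_zero, Real.sqrt_one,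
    scaleFast_one, Pi.zero_apply, mul_zero, h0, zero_dotProduct] at h
  have h1 : ((fun k => w (Sum.inr k)) ⬝ᵥ
      (Matrix.diagonal (N.freq (slow w)) *ᵥ fun k => w (Sum.inr k))) =
      ∑ k, N.freq (slow w) k * w (Sum.inr k) ^ 2 := by
    simp only [dotProduct, Matrix.mulVec_diagonal]
    exact Finset.sum_congr rfl fun k _ => by ring
  have h2 : ((fun _ => 0) ⬝ᵥ (Matrix.diagonal (N.freq (slow w)) *ᵥ fun _ => 0)) = (0 : ℝ) :=
    zero_dotProduct _
  have h3 : ((fun _ => 0) ⬝ᵥ ((N.M₀ (slow w))⁻¹ *ᵥ fun _ => 0)) = (0 : ℝ) := zero_dotProduct _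
  rw [h1, h2, h3] at h
  linarith

theorem V_eq_zero_iff {w : EuclideanSpace ℝ (Fin d ⊕ Fin m)} (hw : w ∈ N.ξ.source) :
    S.V (N.ξ w) = 0 ↔ dropFast w = w := by
  have hf := N.freq_pos (slow w) ⟨w, hw, rfl⟩
  rw [N.V_eq hw, ← sub_eq_zero (a := dropFast w), ← norm_eq_zero (a := dropFast w - w), ← sq_eq_zero_iff (a := ‖dropFast w - w‖),
    norm_dropFast_sub_sq, mul_eq_zero_iff_left (by norm_num),
    Finset.sum_eq_zero_iff_of_nonneg fun k _ => mul_nonneg (hf k).le (sq_nonneg _),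
    Finset.sum_eq_zero_iff_of_nonneg fun k _ => sq_nonneg _]
  simp only [mul_eq_zero, (hf _).ne', false_or]

/-- On the constraint manifold the inverse mass matrix is block diagonal in the coordinates. -/
theorem inv_M_eq {w : EuclideanSpace ℝ (Fin d ⊕ Fin m)} (hw : w ∈ N.ξ.source)
    (hw0 : dropFast w = w) :
    (S.M (N.ξ w))⁻¹ = jacobian N.ξ w *
      (Matrix.fromBlocks (N.M₀ (slow w))⁻¹ 0 0 (Matrix.diagonal (N.freq (slow w))) :
        Matrix (Fin d ⊕ Fin m) (Fin d ⊕ Fin m) ℝ) * (jacobian N.ξ w)ᵀ := by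
  have hV := (N.V_eq_zero_iff hw).2 hw0
  have hM := (S.posDef_M _ (N.target_subset (N.ξ.map_source hw))).1
  have hM₀ := (N.posDef_M₀ (slow w) ⟨w, hw, rfl⟩).1
  rw [Matrix.isHermitian_iff_isSymm] at hM hM₀
  have hw1 : (fun k => w (Sum.inr k)) = (0 : Fin m → ℝ) := by
    ext k
    rw [← hw0]
    rfl
  apply eq_of_dotProduct_mulVec_eq
  · rw [Matrix.IsSymm, Matrix.transpose_nonsing_inv, hM.eq]
  · rw [Matrix.IsSymm, Matrix.transpose_mul, Matrix.transpose_mul, Matrix.transpose_transpose,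
      Matrix.fromBlocks_transpose, Matrix.transpose_nonsing_inv, hM₀.eq, Matrix.diagonal_transpose,
      Matrix.transpose_zero, Matrix.transpose_zero, Matrix.mul_assoc]
  -- With `V = 0`, `q₁ = 0` and `R = 0`, and after `U` cancels, only kinetic energies remain,
  -- related by `p = Aᵀ y`.
  · intro y
    have h := N.hamiltonian_eq hw y
    simp only [StiffSystem.hamiltonian, normalHamiltonian, Real.sqrt_one, scaleFast_one, hV,
      hw1, N.R_zero w hw hw0, Matrix.zero_mulVec, dotProduct_zero, zero_dotProduct] at h
    have hassoc : ∀ B : Matrix (Fin d ⊕ Fin m) (Fin d ⊕ Fin m) ℝ,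
        y ⬝ᵥ ((jacobian N.ξ w * B * (jacobian N.ξ w)ᵀ) *ᵥ y) =
          ((jacobian N.ξ w)ᵀ *ᵥ y) ⬝ᵥ (B *ᵥ ((jacobian N.ξ w)ᵀ *ᵥ y)) := by
      intro B
      rw [← Matrix.mulVec_mulVec, ← Matrix.mulVec_mulVec, Matrix.dotProduct_mulVec,
        Matrix.mulVec_transpose]
    rw [hassoc, Matrix.fromBlocks_mulVec]
    generalize (jacobian N.ξ w)ᵀ *ᵥ y = z at h ⊢
    have hz : z ⬝ᵥ Sum.elim ((N.M₀ (slow w))⁻¹ *ᵥ (z ∘ Sum.inl) + 0 *ᵥ (z ∘ Sum.inr))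
        (0 *ᵥ (z ∘ Sum.inl) + Matrix.diagonal (N.freq (slow w)) *ᵥ (z ∘ Sum.inr)) =
        (fun i => z (Sum.inl i)) ⬝ᵥ ((N.M₀ (slow w))⁻¹ *ᵥ fun i => z (Sum.inl i)) +
        (fun i => z (Sum.inr i)) ⬝ᵥ
          (Matrix.diagonal (N.freq (slow w)) *ᵥ fun i => z (Sum.inr i)) := by
      simp only [Matrix.zero_mulVec, add_zero, zero_add]
      simp [dotProduct, Fintype.sum_sum_type, Function.comp_def]
    rw [hz]
    linarith

theorem contDiffAt_ξ {w : EuclideanSpace ℝ (Fin d ⊕ Fin m)} (hw : w ∈ N.ξ.source) :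
    ContDiffAt ℝ ∞ N.ξ w :=
  N.smooth_ξ.contDiffAt (N.ξ.open_source.mem_nhds hw)

theorem contDiffAt_ξ_symm {x : EuclideanSpace ℝ (Fin n)} (hx : x ∈ N.ξ.target) :
    ContDiffAt ℝ ∞ N.ξ.symm x :=
  N.smooth_ξ_symm.contDiffAt (N.ξ.open_target.mem_nhds hx)

theorem jacobian_ξ_mul_jacobian_symm {w : EuclideanSpace ℝ (Fin d ⊕ Fin m)}
    (hw : w ∈ N.ξ.source) : jacobian N.ξ w * jacobian N.ξ.symm (N.ξ w) = 1 := by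
  have hx := N.ξ.map_source hw
  have hs := N.ξ.left_inv hw
  have h := jacobian_comp (f := N.ξ) (h := N.ξ.symm) (x := N.ξ w)
    (by rw [hs]; exact (N.contDiffAt_ξ hw).differentiableAt (by simp))
    ((N.contDiffAt_ξ_symm hx).differentiableAt (by simp))
  rw [hs] at h
  rw [← h, ← jacobian_id (N.ξ w)]
  exact jacobian_congr (N.ξ.eventually_right_inverse hx)

theorem jacobian_symm_mul_jacobian_ξ {w : EuclideanSpace ℝ (Fin d ⊕ Fin m)}
    (hw : w ∈ N.ξ.source) : jacobian N.ξ.symm (N.ξ w) * jacobian N.ξ w = 1 := by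
  have hx := N.ξ.map_source hw
  rw [← jacobian_comp ((N.contDiffAt_ξ_symm hx).differentiableAt (by simp))
    ((N.contDiffAt_ξ hw).differentiableAt (by simp)), ← jacobian_id w]
  exact jacobian_congr (N.ξ.eventually_left_inverse hw)

/-- The mollifier written without the scaling parameter. -/
noncomputable def proj (x : EuclideanSpace ℝ (Fin n)) : EuclideanSpace ℝ (Fin n) :=
  N.ξ (dropFast (N.ξ.symm x))

theorem contDiffAt_proj {x : EuclideanSpace ℝ (Fin n)} (hx : x ∈ N.ξ.target)
    (hx' : dropFast (N.ξ.symm x) ∈ N.ξ.source) : ContDiffAt ℝ ∞ N.proj x :=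
  (N.contDiffAt_ξ hx').comp x (contDiff_dropFast.contDiffAt.comp x (N.contDiffAt_ξ_symm hx))

theorem jacobian_proj {w : EuclideanSpace ℝ (Fin d ⊕ Fin m)} (hw : w ∈ N.ξ.source)
    (hw0 : dropFast w = w) :
    jacobian N.proj (N.ξ w) = jacobian N.ξ w *
      (Matrix.fromBlocks 1 0 0 0 : Matrix (Fin d ⊕ Fin m) (Fin d ⊕ Fin m) ℝ) *
        jacobian N.ξ.symm (N.ξ w) := by
  have hs := N.ξ.left_inv hw
  have hdiff := (N.contDiffAt_ξ_symm (N.ξ.map_source hw)).differentiableAt (by simp)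
  have hdrop : ∀ q, DifferentiableAt ℝ
      (dropFast : EuclideanSpace ℝ (Fin d ⊕ Fin m) → _) q :=
    fun q => (contDiff_dropFast (k := 1)).differentiable (by simp) q
  have h1 := jacobian_comp (f := N.ξ) (h := fun x => dropFast (N.ξ.symm x)) (x := N.ξ w)
    (by rw [hs, hw0]; exact (N.contDiffAt_ξ hw).differentiableAt (by simp))
    ((hdrop _).comp _ hdiff)
  have h2 := jacobian_comp (hdrop (N.ξ.symm (N.ξ w))) hdiff
  rw [h2, jacobian_dropFast, hs, hw0, ← Matrix.mul_assoc] at h1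
  exact h1

/-- The constraint Jacobian annihilates the slow directions on the constraint manifold. -/
theorem G_mul_jacobian {w : EuclideanSpace ℝ (Fin d ⊕ Fin m)} (hw : w ∈ N.ξ.source)
    (hw0 : dropFast w = w) :
    S.G (N.ξ w) * jacobian N.ξ w *
      (Matrix.fromBlocks 1 0 0 0 : Matrix (Fin d ⊕ Fin m) (Fin d ⊕ Fin m) ℝ) = 0 := by
  have hD := N.target_subset (N.ξ.map_source hw)
  have hdrop : DifferentiableAt ℝ (dropFast : EuclideanSpace ℝ (Fin d ⊕ Fin m) → _) w :=
    (contDiff_dropFast (k := 1)).differentiable (by simp) w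
  have hξ : DifferentiableAt ℝ N.ξ (dropFast w) := by
    rw [hw0]
    exact (N.contDiffAt_ξ hw).differentiableAt (by simp)
  have hg : DifferentiableAt ℝ S.g (N.ξ (dropFast w)) := by
    rw [hw0]
    exact (S.smooth_g.contDiffAt (S.isOpen_D.mem_nhds hD)).differentiableAt (by simp)
  have h1 := jacobian_comp (f := S.g) (h := N.ξ ∘ dropFast) hg (hξ.comp w hdrop)
  have h2 := jacobian_comp hξ hdrop
  -- For every `q` near `w`, the point `ξ(q₀, 0)` lies on the constraint manifold, so this composite
  -- is locally zero.
  have h0 : jacobian (fun q => S.g ((N.ξ ∘ dropFast) q)) w = 0 := by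
    rw [← jacobian_const (0 : EuclideanSpace ℝ (Fin m)) w]
    apply jacobian_congr
    have hev : ∀ᶠ q in 𝓝 w, dropFast q ∈ N.ξ.source :=
      hdrop.continuousAt.eventually (N.ξ.open_source.mem_nhds (by rwa [hw0]))
    filter_upwards [hev] with q hq
    exact (S.V_eq_zero_iff _ (N.target_subset (N.ξ.map_source hq))).1
      ((N.V_eq_zero_iff hq).2 (dropFast_dropFast q))
  rw [h0, show N.ξ ∘ dropFast = fun q => N.ξ (dropFast q) from rfl, h2, jacobian_dropFast] at h1
  simp only [hw0] at h1
  rw [Matrix.mul_assoc]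
  exact h1.symm

/-- The exact identity on the constraint manifold: it gives the second claim and the vanishing of
`projError` needed for the first. -/
theorem isUnit_gram_and_jacobian_proj {w : EuclideanSpace ℝ (Fin d ⊕ Fin m)}
    (hw : w ∈ N.ξ.source) (hw0 : dropFast w = w) :
    IsUnit (S.gram (N.ξ w)).det ∧ (jacobian N.proj (N.ξ w))ᵀ = S.P (N.ξ w) := by
  have hD := N.target_subset (N.ξ.map_source hw)
  have hg := (S.V_eq_zero_iff _ hD).1 ((N.V_eq_zero_iff hw).2 hw0)
  have hΩ : IsUnit (Matrix.diagonal (N.freq (slow w))) := by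
    rw [Matrix.isUnit_diagonal, Pi.isUnit_iff]
    exact fun k => (N.freq_pos (slow w) ⟨w, hw, rfl⟩ k).ne'.isUnit
  have h := constraint_projection_eq (N.jacobian_ξ_mul_jacobian_symm hw)
    (N.jacobian_symm_mul_jacobian_ξ hw) hΩ
    ((S.full_rank _ hD hg).trans (Fintype.card_fin m).symm) (N.G_mul_jacobian hw hw0)
    (N.inv_M_eq hw hw0)
  exact ⟨h.1, by rw [N.jacobian_proj hw hw0]; exact h.2.symm⟩

end NormalForm

/-! ### Regularity of the projection `P`. -/

namespace StiffSystem

variable {n m : ℕ} (S : StiffSystem n m)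

theorem contDiffAt_G {x : EuclideanSpace ℝ (Fin n)} (hx : x ∈ S.D) (i : Fin m) (j : Fin n) :
    ContDiffAt ℝ 1 (fun y => S.G y i j) x :=
  contDiffAt_jacobian (S.smooth_g.contDiffAt (S.isOpen_D.mem_nhds hx)) (by rw [one_add_one_eq_two]; exact WithTop.coe_le_coe.2 le_top) i j

theorem contDiffAt_inv_M {x : EuclideanSpace ℝ (Fin n)} (hx : x ∈ S.D) (i j : Fin n) :
    ContDiffAt ℝ 1 (fun y => (S.M y)⁻¹ i j) x :=
  contDiffAt_matrix_inv
    (fun a b => ((S.smooth_M a b).contDiffAt (S.isOpen_D.mem_nhds hx)).of_le (by simp))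
    (S.posDef_M x hx).det_pos.ne'.isUnit i j

theorem contDiffAt_gram {x : EuclideanSpace ℝ (Fin n)} (hx : x ∈ S.D) (i j : Fin m) :
    ContDiffAt ℝ 1 (fun y => S.gram y i j) x :=
  contDiffAt_matrix_mul
    (contDiffAt_matrix_mul (S.contDiffAt_G hx) (S.contDiffAt_inv_M hx))
    (fun a b => S.contDiffAt_G hx b a) i j

theorem contDiffAt_P {x : EuclideanSpace ℝ (Fin n)} (hx : x ∈ S.D)
    (hgram : IsUnit (S.gram x).det) (i j : Fin n) : ContDiffAt ℝ 1 (fun y => S.P y i j) x :=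
  contDiffAt_const.sub
    (contDiffAt_matrix_mul
      (contDiffAt_matrix_mul
        (contDiffAt_matrix_mul (fun a b => S.contDiffAt_G hx b a)
          (contDiffAt_matrix_inv (S.contDiffAt_gram hx) hgram))
        (S.contDiffAt_G hx))
      (S.contDiffAt_inv_M hx) i j)

end StiffSystem

/-! ### Quantitative estimates near the constraint manifold. -/

namespace NormalForm

variable {n m d : ℕ} {S : StiffSystem n m} (N : NormalForm S d)

/-- The difference between the transposed Jacobian of the mollifier and the projection. -/
noncomputable def projError (x : EuclideanSpace ℝ (Fin n)) :
    EuclideanSpace ℝ (Fin n) →L[ℝ] EuclideanSpace ℝ (Fin n) :=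
  Matrix.toEuclideanCLM (𝕜 := ℝ) ((jacobian N.proj x)ᵀ - S.P x)

theorem contDiffAt_projError {w : EuclideanSpace ℝ (Fin d ⊕ Fin m)} (hw : w ∈ N.ξ.source)
    (hw0 : dropFast w = w) : ContDiffAt ℝ 1 (fun q => N.projError (N.ξ q)) w := by
  have hx := N.ξ.map_source hw
  have hproj : ContDiffAt ℝ ∞ N.proj (N.ξ w) :=
    N.contDiffAt_proj hx (by rw [N.ξ.left_inv hw, hw0]; exact hw)
  refine ContDiffAt.comp (g := N.projError) w ?_ ((N.contDiffAt_ξ hw).of_le (by simp))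
  refine contDiffAt_toEuclideanCLM fun i j => ?_
  exact (contDiffAt_jacobian hproj (by rw [one_add_one_eq_two]; exact WithTop.coe_le_coe.2 le_top) j i).sub
    (S.contDiffAt_P (N.target_subset hx) (N.isUnit_gram_and_jacobian_proj hw hw0).1 i j)

/-- Turns the energy bound into a bound on the fast coordinates, since each frequency has a positive
lower bound on `L`. -/
theorem exists_norm_dropFast_sub_sq_le {L : Set (EuclideanSpace ℝ (Fin d ⊕ Fin m))}
    (hL : IsCompact L) (hLs : L ⊆ N.ξ.source) :
    ∃ Λ, 0 ≤ Λ ∧ ∀ w ∈ L, ‖dropFast w - w‖ ^ 2 ≤ Λ * S.V (N.ξ w) := by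
  have hlam : ∀ k, ∃ a, 0 < a ∧ ∀ w ∈ L, a ≤ N.freq (slow w) k := fun k =>
    hL.exists_forall_le'
      ((N.smooth_freq k).continuousOn.comp continuous_slow.continuousOn
        fun w hw => ⟨w, hLs hw, rfl⟩)
      fun w hw => N.freq_pos _ ⟨w, hLs hw, rfl⟩ k
  choose a ha haL using hlam
  -- From `a_k w_k² ≤ 2 V`, each square is at most `(2 / a_k) V`.
  refine ⟨∑ k, 2 / a k, Finset.sum_nonneg fun k _ => (div_pos two_pos (ha k)).le, ?_⟩
  intro w hw
  rw [norm_dropFast_sub_sq, Finset.sum_mul]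
  refine Finset.sum_le_sum fun k _ => ?_
  have hterm : N.freq (slow w) k * w (Sum.inr k) ^ 2 ≤
      ∑ l, N.freq (slow w) l * w (Sum.inr l) ^ 2 :=
    Finset.single_le_sum (f := fun l => N.freq (slow w) l * w (Sum.inr l) ^ 2)
      (fun l _ => mul_nonneg (N.freq_pos _ ⟨w, hLs hw, rfl⟩ l).le (sq_nonneg _))
      (Finset.mem_univ k)
  have hlow := mul_le_mul_of_nonneg_right (haL k w hw) (sq_nonneg (w (Sum.inr k)))
  rw [div_mul_eq_mul_div, le_div_iff₀ (ha k), N.V_eq (hLs hw)]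
  linarith

/-- Uniform Lipschitz estimates near the constraint manifold. -/
theorem exists_uniform_bounds {L : Set (EuclideanSpace ℝ (Fin d ⊕ Fin m))}
    (hL : IsCompact L) (hLs : L ⊆ N.ξ.source) :
    ∃ C δ, 0 < δ ∧ ∀ w ∈ L, ‖dropFast w - w‖ ≤ δ →
      dropFast w ∈ N.ξ.source ∧ IsUnit (S.gram (N.ξ w)).det ∧
      ‖N.ξ (dropFast w) - N.ξ w‖ ≤ C * ‖dropFast w - w‖ ∧
      ‖N.projError (N.ξ w)‖ ≤ C * ‖dropFast w - w‖ := by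
  have hcont : Continuous (dropFast : EuclideanSpace ℝ (Fin d ⊕ Fin m) → _) :=
    (contDiff_dropFast (k := 1)).continuous
  refine IsCompact.exists_uniform_of_eventually hL
    (ρ := fun w => ‖dropFast w - w‖) (hcont.sub continuous_id).norm
    (p := fun C w => dropFast w ∈ N.ξ.source ∧ IsUnit (S.gram (N.ξ w)).det ∧
      ‖N.ξ (dropFast w) - N.ξ w‖ ≤ C * ‖dropFast w - w‖ ∧
      ‖N.projError (N.ξ w)‖ ≤ C * ‖dropFast w - w‖) ?_ ?_
  · rintro w C C' hC ⟨h1, h2, h3, h4⟩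
    have := mul_le_mul_of_nonneg_right hC (norm_nonneg (dropFast w - w))
    exact ⟨h1, h2, h3.trans this, h4.trans this⟩
  · intro w hwL hw0
    have hw := hLs hwL
    replace hw0 : dropFast w = w := sub_eq_zero.1 (norm_le_zero_iff.1 hw0)
    have hu := (N.isUnit_gram_and_jacobian_proj hw hw0).1
    obtain ⟨C₁, h₁⟩ := exists_eventually_norm_sub_le_of_contDiffAt hcont hw0
      ((N.contDiffAt_ξ hw).of_le (m := 1) (by simp))
    obtain ⟨C₂, h₂⟩ := exists_eventually_norm_sub_le_of_contDiffAt hcont hw0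
      (N.contDiffAt_projError hw hw0)
    have hsrc : ∀ᶠ q in 𝓝 w, dropFast q ∈ N.ξ.source :=
      hcont.continuousAt.eventually (N.ξ.open_source.mem_nhds (by rwa [hw0]))
    have hdet : ContinuousAt (fun q => (S.gram (N.ξ q)).det) w :=
      ContinuousAt.comp (f := N.ξ) (g := fun x => (S.gram x).det)
        (contDiffAt_matrix_det
          (S.contDiffAt_gram (N.target_subset (N.ξ.map_source hw)))).continuousAt
        (N.contDiffAt_ξ hw).continuousAt
    refine ⟨max C₁ C₂, mem_nhdsWithin_of_mem_nhds ?_⟩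
    filter_upwards [h₁, h₂, hsrc, hdet.eventually_ne hu.ne_zero] with q hq₁ hq₂ hqs hqd
    refine ⟨hqs, hqd.isUnit, hq₁.trans ?_, ?_⟩
    · exact mul_le_mul_of_nonneg_right (le_max_left _ _) (norm_nonneg _)
    -- `dropFast q` lies on the flat manifold `{q₁ = 0}`, so the Lipschitz bound on the difference
    -- bounds the error at `q` itself.
    · have hzero : N.projError (N.ξ (dropFast q)) = 0 := by
        rw [projError, (N.isUnit_gram_and_jacobian_proj hqs (dropFast_dropFast q)).2, sub_self,
          map_zero]
      rw [hzero, zero_sub, norm_neg] at hq₂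
      exact hq₂.trans (mul_le_mul_of_nonneg_right (le_max_right _ _) (norm_nonneg _))

end NormalForm

end StiffMech

/-! ### Both claims assembled. -/

theorem mainTheorem5 {n d m : ℕ} (hn : n = d + m)
    (S : StiffMech.StiffSystem n m) (N : StiffMech.NormalForm S d) :
    -- estimates under `V(x) = O(ε²)`, uniformly on compact sets
    (∀ K : Set (EuclideanSpace ℝ (Fin n)), IsCompact K → K ⊆ N.ξ.target → ∀ c : ℝ,
      ∃ C ε₀ : ℝ, 0 < ε₀ ∧ ∀ (ε : ℝ) (hε : 0 < ε), ε ≤ ε₀ →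
        ∀ x ∈ K, S.V x ≤ c * ε ^ 2 →
          -- `π` and `P` are well defined at `x`
          StiffMech.dropFast ((StiffMech.chi N.ξ ε hε).symm x) ∈ (StiffMech.chi N.ξ ε hε).source ∧
          DifferentiableAt ℝ (StiffMech.mollifier (StiffMech.chi N.ξ ε hε)) x ∧
          IsUnit (S.gram x).det ∧
          -- `π(x) = x + O(ε)` and `π'(x)ᵀ = P(x) + O(ε)`
          ‖StiffMech.mollifier (StiffMech.chi N.ξ ε hε) x - x‖ ≤ C * ε ∧
          ‖Matrix.toEuclideanCLM (𝕜 := ℝ)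
              ((StiffMech.jacobian (StiffMech.mollifier (StiffMech.chi N.ξ ε hε)) x)ᵀ - S.P x)‖
            ≤ C * ε) ∧
    -- `π'(X)ᵀ = P(X)` on the constraint manifold
    (∀ (ε : ℝ) (hε : 0 < ε), ∀ X ∈ N.ξ.target, S.g X = 0 →
      StiffMech.dropFast ((StiffMech.chi N.ξ ε hε).symm X) ∈ (StiffMech.chi N.ξ ε hε).source ∧
      DifferentiableAt ℝ (StiffMech.mollifier (StiffMech.chi N.ξ ε hε)) X ∧
      IsUnit (S.gram X).det ∧
      (StiffMech.jacobian (StiffMech.mollifier (StiffMech.chi N.ξ ε hε)) X)ᵀ = S.P X) := by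
  have hmol : ∀ {ε : ℝ} (hε : 0 < ε), StiffMech.mollifier (StiffMech.chi N.ξ ε hε) = N.proj :=
    fun hε => StiffMech.mollifier_chi N.ξ hε
  simp only [hmol, StiffMech.dropFast_chi_symm_mem_iff]
  refine ⟨?_, ?_⟩
  · intro K hK hKt c
    have hL : IsCompact (N.ξ.symm '' K) :=
      hK.image_of_continuousOn (N.ξ.continuousOn_symm.mono hKt)
    have hLs : N.ξ.symm '' K ⊆ N.ξ.source := by
      rintro _ ⟨x, hx, rfl⟩
      exact N.ξ.map_target (hKt hx)
    obtain ⟨C, δ, hδ, hC⟩ := N.exists_uniform_bounds hL hLs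
    obtain ⟨Λ, hΛ, hV⟩ := N.exists_norm_dropFast_sub_sq_le hL hLs
    -- `B ε` will bound the fast coordinates; `max c 0` keeps the radicand nonnegative for negative
    -- `c`.
    set B := √(Λ * max c 0)
    have hB : 0 ≤ B := Real.sqrt_nonneg _
    -- `B + 1` avoids division by zero and still gives `B ε ≤ δ`; `max C 0` is needed because `C`
    -- has no sign.
    refine ⟨max C 0 * B, δ / (B + 1), by positivity, ?_⟩
    intro ε hε hε₀ x hx hVx
    have hxt := hKt hx
    have hinv := N.ξ.right_inv hxt
    have hdist : ‖StiffMech.dropFast (N.ξ.symm x) - N.ξ.symm x‖ ≤ B * ε := by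
      refine (sq_le_sq₀ (norm_nonneg _) (by positivity)).1 ?_
      rw [mul_pow, Real.sq_sqrt (mul_nonneg hΛ (le_max_right _ _))]
      refine (hV _ ⟨x, hx, rfl⟩).trans ?_
      rw [hinv, mul_assoc]
      refine mul_le_mul_of_nonneg_left (hVx.trans ?_) hΛ
      exact mul_le_mul_of_nonneg_right (le_max_left _ _) (sq_nonneg _)
    have hsmall : B * ε ≤ δ := by
      rw [le_div_iff₀ (by positivity)] at hε₀
      nlinarith
    obtain ⟨h1, h2, h3, h4⟩ := hC _ ⟨x, hx, rfl⟩ (hdist.trans hsmall)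
    rw [hinv] at h2 h3 h4
    have hbound : C * ‖StiffMech.dropFast (N.ξ.symm x) - N.ξ.symm x‖ ≤ max C 0 * B * ε := by
      rw [mul_assoc]
      exact mul_le_mul (le_max_left _ _) hdist (norm_nonneg _) (le_max_right _ _)
    exact ⟨h1, (N.contDiffAt_proj hxt h1).differentiableAt (by simp), h2, h3.trans hbound,
      h4.trans hbound⟩
  · intro ε hε X hX hg
    have hw := N.ξ.map_target hX
    have hinv := N.ξ.right_inv hX
    have hV := (S.V_eq_zero_iff X (N.target_subset hX)).2 hg
    have hw0 : StiffMech.dropFast (N.ξ.symm X) = N.ξ.symm X :=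
      (N.V_eq_zero_iff hw).1 (by rwa [hinv])
    have hsrc : StiffMech.dropFast (N.ξ.symm X) ∈ N.ξ.source := by rwa [hw0]
    have h := N.isUnit_gram_and_jacobian_proj hw hw0
    rw [hinv] at h
    exact ⟨hsrc, (N.contDiffAt_proj hX hsrc).differentiableAt (by simp), h⟩
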